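/- Let $d\in\{2,3\}$ and let $\mathcal T_h$ be a finite conforming mesh (no hanging nodes) of nondegenerate closed $d$-simplices in $\mathbb R^d$, partitioning the domain $\Omega=\operatorname{int}\bigcup_{T\in\mathcal T_h}T$. Let the coefficient $\kappa$ be constant and positive on each element, $\kappa_T=\kappa|_T>0$. Let $\mathcal E_h$ be the set of all faces (edges if $d=2$) of elements, and $\mathcal E_h^o$ the set of interior faces, i.e. those shared by two different elements. For $e\in\mathcal E_h^o$ label the two elements containing $e$ as $T^+,T^-$ (in either order), let $n^\pm$ be their outward unit normals on $e$, write $\zeta^\pm$ for the trace on $e$ of $\zeta|_{T^\pm}$, $\kappa^\pm=\kappa_{T^\pm}$, and set $$\beta_e=\frac{\kappa^-}{\kappa^++\kappa^-},\qquad \kappa_e=\frac{2\kappa^+\kappa^-}{\kappa^++\kappa^-},\qquad \{\zeta\}_{\delta}=\delta\,\zeta^++(1-\delta)\,\zeta^-,\qquad [\![\zeta]\!]=\zeta^+n^++\zeta^-n^- ,$$ where $\{\cdot\}_\delta$ is defined in the same way for vector fields. For a boundary face $e$ of an element $T$ with outward unit normal $n$ set $[\![\zeta]\!]=\zeta n$,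 $\{\tau\}_{\beta_e}=\tau$, $\kappa_e=\kappa_T$. Let $h_e$ be the $(d-1)$-dimensional Lebesgue measure of $e$ and $\mathcal P^0_e$ the $L^2(e)$-projection onto constants (the mean value over $e$). Let $V_h^{DG}$ be the space of all $v\in L^2(\Omega)$ such that $v|_T$ is a polynomial of degree at most one for every $T\in\mathcal T_h$, and $$\mathcal Z_\beta=\{z\in V_h^{DG}:\ \mathcal P^0_e(\{z\}_{1-\beta_e})=0\ \text{ for all } e\in\mathcal E_h^o\}.$$ For $\alpha>0$ and $\theta\in\{-1,0,1\}$ define, for $v,w\in V_h^{DG}$, the IP($\beta$)-0 bilinear form $$\mathcal A_0(v,w)=\sum_{T\in\mathcal T_h}\int_T\kappa_T\nabla v\cdot\nabla w\,dx-\sum_{e\in\mathcal E_h}\int_e\{\kappa\nabla v\}_{\beta_e}\cdot[\![w]\!]\,ds+\theta\sum_{e\in\mathcal E_h}\int_e[\![v]\!]\cdot\{\kappa\nabla w\}_{\beta_e}\,ds+\sum_{e\in\mathcal E_h}\int_e\alpha h_e^{-1}\kappa_e\,\mathcal P^0_e([\![v]\!])\cdot[\![w]\!]\,ds .$$ Then,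 for each of $\theta=-1,0,1$, the restriction of $\mathcal A_0$ to $\mathcal Z_\beta$ is symmetric: $$\mathcal A_0(z,\psi)=\mathcal A_0(\psi,z)\qquad\text{for all } z,\psi\in\mathcal Z_\beta .$$ -/

import Mathlib

open MeasureTheory
open scoped Gradient

noncomputable section

namespace IPDG

/-- The ambient space `ℝ^d` with its Euclidean structure. -/
abbrev Pt (d : ℕ) : Type := EuclideanSpace ℝ (Fin d)

/-- The closed simplex (element or face) spanned by a finite set of vertices. -/
def hull {d : ℕ} (s : Finset (Pt d)) : Set (Pt d) := convexHull ℝ (s : Set (Pt d))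

/-- The mass center of the simplex spanned by `s`. -/
def massCenter {d : ℕ} (s : Finset (Pt d)) : Pt d := (s.card : ℝ)⁻¹ • ∑ p ∈ s, p

/-- A conforming (no hanging nodes) mesh of nondegenerate `d`-simplices in `ℝ^d`.
An element is given by its set of `d + 1` vertices; two closed elements meet exactly in the
simplex spanned by their common vertices (which is empty if there are none). -/
structure Mesh (d : ℕ) where
  elems : Finset (Finset (Pt d))
  card_elem : ∀ T ∈ elems, T.card = d + 1
  indep : ∀ T ∈ elems, AffineIndependent ℝ (fun p : T => (p : Pt d))
  conforming : ∀ T ∈ elems, ∀ T' ∈ elems,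
    hull T ∩ hull T' = convexHull ℝ ((T : Set (Pt d)) ∩ (T' : Set (Pt d)))

/-- The outward unit normal of the simplex `T` on its face `e`: the normalized component of
`massCenter e - massCenter T` orthogonal to the face. -/
def normal {d : ℕ} (T e : Finset (Pt d)) : Pt d :=
  let w := (vectorSpan ℝ (e : Set (Pt d)))ᗮ.starProjection (massCenter e - massCenter T)
  ‖w‖⁻¹ • w

namespace Mesh

variable {d : ℕ} (M : Mesh d)

/-- The open domain `Ω` that is partitioned by the mesh. -/
def domain : Set (Pt d) := interior (⋃ T ∈ M.elems, hull T)

open Classical in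
/-- All edges (`d = 2`) or faces (`d = 3`) of the elements, given by their `d` vertices. -/
def faces : Finset (Finset (Pt d)) := M.elems.biUnion fun T => T.powersetCard d

open Classical in
/-- The interior faces: those shared by two different elements. The other faces are the
boundary faces. -/
def interiorFaces : Finset (Finset (Pt d)) :=
  M.faces.filter fun e => ∃ T ∈ M.elems, ∃ T' ∈ M.elems, T ≠ T' ∧ e ⊆ T ∧ e ⊆ T'

/-- A labelling `T⁺`, `T⁻` of the two elements at each interior face. On a boundary face,
`plus` is the element containing it and `minus` is not used. -/
structure Labelling where
  plus : Finset (Pt d) → Finset (Pt d)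
  minus : Finset (Pt d) → Finset (Pt d)
  plus_mem : ∀ e ∈ M.faces, plus e ∈ M.elems
  subset_plus : ∀ e ∈ M.faces, e ⊆ plus e
  minus_mem : ∀ e ∈ M.interiorFaces, minus e ∈ M.elems
  subset_minus : ∀ e ∈ M.interiorFaces, e ⊆ minus e
  minus_ne_plus : ∀ e ∈ M.interiorFaces, minus e ≠ plus e

/-- The space `L²(Ω)`. -/
abbrev L2 : Type := Lp ℝ 2 (volume.restrict M.domain)

/-- `v` coincides on the element `T` with the polynomial `p` of degree at most one. -/
def AgreesOn (v : M.L2) (T : Finset (Pt d)) (p : Pt d →ᵃ[ℝ] ℝ) : Prop :=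
  ∀ᵐ x ∂(volume.restrict (interior (hull T))), v x = p x

/-- The piecewise linear discontinuous finite element space. -/
def VDG : Set M.L2 := {v | ∀ T ∈ M.elems, ∃ p : Pt d →ᵃ[ℝ] ℝ, M.AgreesOn v T p}

open Classical in
/-- The restriction of `v` to the element `T`, as a polynomial of degree at most one
(`0` if `v` is not such a polynomial on `T`). It provides the trace of `v` on the faces of `T`
from within `T`, and `∇ v` in `T`. -/
def loc (v : M.L2) (T : Finset (Pt d)) : Pt d →ᵃ[ℝ] ℝ :=
  if h : ∃ p : Pt d →ᵃ[ℝ] ℝ, M.AgreesOn v T p then h.choose else 0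

variable {M}

/-- On an element, a polynomial of degree at most one is determined by the values almost
everywhere, so `loc` is the only possible choice. -/
theorem loc_eq {v : M.L2} {T : Finset (Pt d)} (hT : T ∈ M.elems) {p : Pt d →ᵃ[ℝ] ℝ}
    (hp : M.AgreesOn v T p) : M.loc v T = p := by
  have hex : ∃ p : Pt d →ᵃ[ℝ] ℝ, M.AgreesOn v T p := ⟨p, hp⟩
  have hloc : M.AgreesOn v T (M.loc v T) := by
    unfold loc
    rw [dif_pos hex]
    exact hex.choose_spec
  have hspan : affineSpan ℝ (T : Set (Pt d)) = ⊤ := by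
    have h := (M.indep T hT).affineSpan_eq_top_iff_card_eq_finrank_add_one.2
      (by simp [M.card_elem T hT])
    simpa using h
  have hne : (interior (hull T)).Nonempty := by
    unfold hull
    exact interior_convexHull_nonempty_iff_affineSpan_eq_top.2 hspan
  have hcont : ∀ q : Pt d →ᵃ[ℝ] ℝ, Continuous q := fun q => q.continuous_of_finiteDimensional
  have hEq : Set.EqOn (M.loc v T) p (interior (hull T)) := by
    refine Measure.eqOn_open_of_ae_eq (μ := volume) ?_ isOpen_interior
      (hcont _).continuousOn (hcont _).continuousOn
    filter_upwards [hloc, hp] with x h1 h2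
    rw [← h1, h2]
  refine AffineMap.ext_on ?_ hEq
  exact isOpen_interior.affineSpan_eq_top hne

namespace Labelling

variable (L : M.Labelling) (κ : Finset (Pt d) → ℝ)

/-- The weight `β_e = κ⁻ / (κ⁺ + κ⁻)` of an interior face. -/
def beta (e : Finset (Pt d)) : ℝ := κ (L.minus e) / (κ (L.plus e) + κ (L.minus e))

open Classical in
/-- `κ_e`: the harmonic mean of `κ⁺` and `κ⁻` on an interior face, and the coefficient of the
adjacent element on a boundary face. -/
def kappaFace (e : Finset (Pt d)) : ℝ :=
  if e ∈ M.interiorFaces then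
    2 * κ (L.plus e) * κ (L.minus e) / (κ (L.plus e) + κ (L.minus e))
  else κ (L.plus e)

/-- The weighted average `δ ζ⁺ + (1 - δ) ζ⁻` of a scalar function on an interior face. -/
def avg (δ : ℝ) (v : M.L2) (e : Finset (Pt d)) (x : Pt d) : ℝ :=
  δ * M.loc v (L.plus e) x + (1 - δ) * M.loc v (L.minus e) x

open Classical in
/-- The weighted average of the flux `κ ∇ v` with weight `β_e` on a face; on a boundary face it
is the flux itself. -/
def avgFlux (v : M.L2) (e : Finset (Pt d)) (x : Pt d) : Pt d :=
  if e ∈ M.interiorFaces then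
    L.beta κ e • (κ (L.plus e) • ∇ (M.loc v (L.plus e)) x) +
      (1 - L.beta κ e) • (κ (L.minus e) • ∇ (M.loc v (L.minus e)) x)
  else κ (L.plus e) • ∇ (M.loc v (L.plus e)) x

open Classical in
/-- The (vector valued) jump `v⁺ n⁺ + v⁻ n⁻` on an interior face, and `v n` on a boundary face. -/
def jump (v : M.L2) (e : Finset (Pt d)) (x : Pt d) : Pt d :=
  if e ∈ M.interiorFaces then
    M.loc v (L.plus e) x • normal (L.plus e) e + M.loc v (L.minus e) x • normal (L.minus e) e
  else M.loc v (L.plus e) x • normal (L.plus e) e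

end Labelling

/-- The `(d-1)`-dimensional Lebesgue (surface) measure on the face `e`. -/
def surf (e : Finset (Pt d)) : Measure (Pt d) :=
  (Measure.euclideanHausdorffMeasure (d - 1)).restrict (hull e)

/-- The `L²` projection onto the constants on the face `e`, that is, the mean value over `e`. -/
def proj {F : Type*} [NormedAddCommGroup F] [NormedSpace ℝ F] (e : Finset (Pt d))
    (f : Pt d → F) : F := ⨍ x, f x ∂(surf e)

/-- `h_e`, the `(d-1)`-dimensional measure of the face `e`. -/
def faceSize (e : Finset (Pt d)) : ℝ := (surf e).real Set.univ

namespace Labelling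

variable (L : M.Labelling) (κ : Finset (Pt d) → ℝ)

/-- The space `Z_β` of piecewise linear functions whose average with weight `1 - β_e` has mean
value zero on every interior face. -/
def Z : Set M.L2 :=
  {z | z ∈ M.VDG ∧ ∀ e ∈ M.interiorFaces, proj e (L.avg (1 - L.beta κ e) z e) = 0}

/-- The bilinear form of the IP(β)-0 method with penalty parameter `α`. -/
def A0 (α θ : ℝ) (v w : M.L2) : ℝ :=
  (∑ T ∈ M.elems, ∫ x in hull T, inner ℝ (κ T • ∇ (M.loc v T) x) (∇ (M.loc w T) x))
    - (∑ e ∈ M.faces, ∫ x, inner ℝ (L.avgFlux κ v e x) (L.jump w e x) ∂(surf e))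
    + θ * (∑ e ∈ M.faces, ∫ x, inner ℝ (L.jump v e x) (L.avgFlux κ w e x) ∂(surf e))
    + ∑ e ∈ M.faces, ∫ x, inner ℝ
        ((α * (faceSize e)⁻¹ * L.kappaFace κ e) • proj e (L.jump v e)) (L.jump w e x) ∂(surf e)

end Labelling

end Mesh

end IPDG

end

noncomputable section
open Module

/-! ### Surface measure on hyperplanes and its behaviour under affine involutions -/

namespace AffineMap

/-! The volume and penalty terms are symmetric by inspection; everything rests on the consistency
term. On an interior face the normals are opposite and gradients are constant, so the sum of the
outward fluxes tested with the traces from within differs from the integral of `{κ∇v}_β · [[w]]` by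
the constant flux jump times the integral of `{w}_{1-β}`, which vanishes on `Z`
(`integral_avgFlux_jump`). Regrouped by elements, the term becomes the sum of `κ_T ∫_{∂T} w ∇v·n`.
By the divergence theorem this is `κ_T C_T ∇v·∇w` on each `T`, which is symmetric
(`sum_integral_avgFlux_jump_comm`). The `θ` term is the same form with its arguments exchanged.

The divergence theorem is needed only for a constant field times an affine function, with any
constant `C_T`. In barycentric coordinates it reduces to one fact: after dividing the measure of the
face opposite vertex `i` by `|∇λ_i|`, the integral of `λ_j` is the same for all `i ≠ j`
(`AffineBasis.integral_coord_eq`). The affine maps exchanging two vertices give this. They preserve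
volume, and the scaled surface measure of a set is the volume of a prism over it (`volume_prism`).
-/

theorem linear_linear_of_involutive {E : Type*} [AddCommGroup E] [Module ℝ E]
    (σ : E →ᵃ[ℝ] E) (hσ : ∀ x, σ (σ x) = x) (w : E) :
    σ.linear (σ.linear w) = w := by
  have h := σ.map_vadd (σ 0) (σ.linear w)
  have h1 := σ.map_vadd (0 : E) w
  have h2 := hσ (w +ᵥ (0 : E))
  rw [h1, h, hσ 0] at h2
  simpa using h2

variable {E : Type*} [NormedAddCommGroup E] [InnerProductSpace ℝ E] [FiniteDimensional ℝ E]

/-- The constant gradient of an affine function. -/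
def gradVec (f : E →ᵃ[ℝ] ℝ) : E :=
  (InnerProductSpace.toDual ℝ E).symm (LinearMap.toContinuousLinearMap f.linear)

theorem inner_gradVec (f : E →ᵃ[ℝ] ℝ) (u : E) : inner ℝ f.gradVec u = f.linear u := by
  simp [gradVec]

theorem apply_eq_add_inner (f : E →ᵃ[ℝ] ℝ) (x y : E) :
    f x = f y + inner ℝ f.gradVec (x - y) := by
  rw [inner_gradVec]
  have h := f.linearMap_vsub x y
  simp only [vsub_eq_sub] at h
  linarith

theorem gradient_eq_gradVec (f : E →ᵃ[ℝ] ℝ) (x : E) : ∇ (f : E → ℝ) x = f.gradVec := by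
  apply HasGradientAt.gradient
  rw [hasGradientAt_iff_hasFDerivAt]
  have h : (f : E → ℝ) = fun y => InnerProductSpace.toDual ℝ E f.gradVec (y - x) + f x := by
    funext y
    rw [f.apply_eq_add_inner y x]
    simp [add_comm]
  rw [h]
  simp only [map_sub]
  exact ((InnerProductSpace.toDual ℝ E f.gradVec).hasFDerivAt.sub_const _).add_const _

variable [MeasurableSpace E] [BorelSpace E]

/-- The volume of the prism over a subset `A` of the hyperplane `f = 0`. -/
theorem volume_prism (f : E →ᵃ[ℝ] ℝ) {u : E} (hu : f.linear u = 1) {A : Set E}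
    (hA : MeasurableSet A) (hAf : ∀ x ∈ A, f x = 0) (hne : A.Nonempty) :
    volume {x | f x ∈ Set.Icc (0 : ℝ) 1 ∧ x - f x • u ∈ A} =
      ‖f.gradVec‖ₑ⁻¹ * μHE[finrank ℝ E - 1] A := by
  obtain ⟨p, hp⟩ := hne
  have hfc : Continuous f := f.continuous_of_finiteDimensional
  have hg : f.gradVec ≠ 0 := by
    intro h0
    have := f.inner_gradVec u
    rw [h0, hu] at this
    simp at this
  set g := f.gradVec with hgdef
  have hgn : ‖g‖ ≠ 0 := by simpa using hg
  -- This scaling makes `f` grow by `t` along `t • v`, so the slices orthogonal to `v` are the level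
  -- sets of `f`; the norm of `v` yields the factor `‖g‖⁻¹`.
  set v : E := (‖g‖ ^ 2)⁻¹ • g with hv
  have hv0 : v ≠ 0 := by simp [hv, hg]
  have hvn : ‖v‖ₑ = ‖g‖ₑ⁻¹ := by
    rw [hv, enorm_smul, ← enorm_norm g, ← enorm_mul, ← enorm_inv hgn]
    congr 1
    field_simp
  have hmeas : MeasurableSet {x | f x ∈ Set.Icc (0 : ℝ) 1 ∧ x - f x • u ∈ A} := by
    refine (hfc.measurable measurableSet_Icc).inter ?_
    have : Continuous fun x => x - f x • u := by fun_prop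
    exact this.measurable hA
  have hslice : ∀ (t : ℝ) (x : E),
      x ∈ AffineSubspace.mk' (t • v +ᵥ p) (ℝ ∙ v)ᗮ ↔ f x = t := by
    intro t x
    rw [AffineSubspace.mem_mk', Submodule.mem_orthogonal_singleton_iff_inner_right]
    have h1 := f.apply_eq_add_inner x p
    rw [hAf p hp, ← hgdef] at h1
    simp only [vsub_eq_sub, vadd_eq_add, hv, inner_smul_left, inner_sub_right, inner_add_right,
      inner_smul_right, real_inner_self_eq_norm_sq, RCLike.conj_to_real] at h1 ⊢
    rw [h1]
    field_simp
    constructor <;> intro h <;> linarith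
  rw [← InnerProductSpace.euclideanHausdorffMeasure_eq_volume,
    EuclideanGeometry.euclideanHausdorffMeasure_eq_lintegral p hv0 hmeas, hvn]
  congr 1
  -- The slice at height `t` of the oblique prism is the translate of `A` by `t • u`, or empty
  -- outside `[0, 1]`.
  have key : ∀ t : ℝ, μHE[finrank ℝ E - 1]
      ({x | f x ∈ Set.Icc (0 : ℝ) 1 ∧ x - f x • u ∈ A} ∩
        (AffineSubspace.mk' (t • v +ᵥ p) (ℝ ∙ v)ᗮ : Set E)) =
      (Set.Icc (0 : ℝ) 1).indicator (fun _ => μHE[finrank ℝ E - 1] A) t := by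
    intro t
    by_cases ht : t ∈ Set.Icc (0 : ℝ) 1
    · rw [Set.indicator_of_mem ht, ← (isometry_add_left (t • u)).euclideanHausdorffMeasure_image A]
      congr 1
      ext x
      simp only [Set.mem_inter_iff, Set.mem_ofPred_eq, SetLike.mem_coe, hslice, Set.mem_image]
      constructor
      · rintro ⟨⟨-, h⟩, rfl⟩
        exact ⟨_, h, by abel⟩
      · rintro ⟨a, ha, rfl⟩
        have : f (t • u + a) = t := by
          have := f.map_vadd a (t • u)
          rw [hAf a ha] at this
          simpa [hu] using this
        rw [this]
        exact ⟨⟨ht, by simpa using ha⟩, rfl⟩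
    · rw [Set.indicator_of_notMem ht]
      convert measure_empty (μ := (μHE[finrank ℝ E - 1] : Measure E))
      ext x
      simp only [Set.mem_inter_iff, Set.mem_ofPred_eq, SetLike.mem_coe, hslice]
      constructor
      · rintro ⟨⟨h, -⟩, rfl⟩
        exact ht h
      · simp
  simp_rw [key]
  rw [lintegral_indicator_const measurableSet_Icc]
  simp

/-- A compact subset of the hyperplane `f = 0` has finite surface measure. -/
theorem hausdorff_lt_top_of_isCompact (f : E →ᵃ[ℝ] ℝ) (hf : f.linear ≠ 0) {A : Set E}
    (hA : IsCompact A) (hAf : ∀ x ∈ A, f x = 0) : μHE[finrank ℝ E - 1] A < ⊤ := by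
  obtain rfl | hne := A.eq_empty_or_nonempty
  · simp
  obtain ⟨u, hu⟩ : ∃ u, f.linear u = 1 := LinearMap.surjective hf 1
  have h := f.volume_prism hu hA.measurableSet hAf hne
  have hbdd : volume {x | f x ∈ Set.Icc (0 : ℝ) 1 ∧ x - f x • u ∈ A} < ⊤ := by
    have hK : IsCompact ((fun q : E × ℝ => q.1 + q.2 • u) '' (A ×ˢ Set.Icc (0 : ℝ) 1)) :=
      (hA.prod isCompact_Icc).image (by fun_prop)
    refine (measure_mono ?_).trans_lt hK.measure_lt_top
    rintro x ⟨h1, h2⟩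
    exact ⟨(x - f x • u, f x), ⟨h2, h1⟩, by simp⟩
  rw [h] at hbdd
  by_contra htop
  rw [not_lt, top_le_iff] at htop
  rw [htop, ENNReal.mul_top] at hbdd
  · simp at hbdd
  · simp

/-- An affine involution preserves the volume. -/
theorem measurePreserving_of_involutive (σ : E →ᵃ[ℝ] E) (hσ : ∀ x, σ (σ x) = x) :
    MeasurePreserving σ volume volume := by
  have hdet : LinearMap.det σ.linear * LinearMap.det σ.linear = 1 := by
    rw [← LinearMap.det_comp]
    have : σ.linear ∘ₗ σ.linear = LinearMap.id :=
      LinearMap.ext (linear_linear_of_involutive σ hσ)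
    rw [this, LinearMap.det_id]
  have h0 : LinearMap.det σ.linear ≠ 0 := by
    intro h
    simp [h] at hdet
  have habs : |(LinearMap.det σ.linear)⁻¹| = 1 := by
    rcases mul_self_eq_one_iff.1 hdet with h | h <;> simp [h]
  have hlin : MeasurePreserving σ.linear volume volume := by
    refine ⟨(LinearMap.continuous_of_finiteDimensional _).measurable, ?_⟩
    rw [Measure.map_linearMap_addHaar_eq_smul_addHaar volume h0, habs]
    simp
  have := (measurePreserving_add_right volume (σ 0)).comp hlin
  convert this using 1
  funext x
  simpa using congrFun σ.decomp x

/-- Volume preserving affine involutions preserve the surface measure on hyperplanes, scaled by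
the gradient of the defining affine function. -/
theorem hausdorff_preimage_of_involutive (f : E →ᵃ[ℝ] ℝ) (hf : f.linear ≠ 0) (σ : E →ᵃ[ℝ] E)
    (hσ : ∀ x, σ (σ x) = x) {A : Set E} (hA : MeasurableSet A) (hAf : ∀ x ∈ A, f x = 0) :
    ‖(f.comp σ).gradVec‖ₑ⁻¹ * μHE[finrank ℝ E - 1] (σ ⁻¹' A) =
      ‖f.gradVec‖ₑ⁻¹ * μHE[finrank ℝ E - 1] A := by
  obtain rfl | ⟨p, hp⟩ := A.eq_empty_or_nonempty
  · simp
  obtain ⟨u, hu⟩ : ∃ u, f.linear u = 1 := LinearMap.surjective hf 1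
  have hmp := measurePreserving_of_involutive σ hσ
  have hlin := linear_linear_of_involutive σ hσ
  rw [← f.volume_prism hu hA hAf ⟨p, hp⟩,
    ← (f.comp σ).volume_prism (u := σ.linear u) (by simpa [hlin] using hu)
      (hmp.measurable hA) (fun x hx => hAf _ hx) ⟨σ p, by simpa [hσ] using hp⟩]
  let e : E ≃ᵐ E := ⟨⟨σ, σ, hσ, hσ⟩, hmp.measurable, hmp.measurable⟩
  have he : MeasurePreserving e volume volume := hmp
  refine Eq.trans ?_ (he.measure_preimage_equiv _)
  congr 1
  ext x
  -- `σ` carries the prism over `σ ⁻¹' A` with direction `σ.linear u` to the prism over `A` with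
  -- direction `u`.
  have h3 : σ (x - f (σ x) • σ.linear u) = σ x - f (σ x) • u := by
    have := σ.map_vadd x (-(f (σ x) • σ.linear u))
    rw [vadd_eq_add, neg_add_eq_sub] at this
    rw [this]
    simp [hlin, neg_add_eq_sub]
  simp [e, h3]

end AffineMap

/-! ### Moments on the faces of a simplex and the divergence theorem -/

namespace AffineBasis

variable {ι E : Type*} [NormedAddCommGroup E] [InnerProductSpace ℝ E] (b : AffineBasis ι ℝ E)

theorem apply_eq_sum_coord [Fintype ι] (w : E →ᵃ[ℝ] ℝ) (x : E) :
    w x = ∑ j, w (b j) * b.coord j x := by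
  have h := congrArg w (b.affineCombination_coord_eq_self x)
  rw [Finset.map_affineCombination _ _ _ (b.sum_coord_apply_eq_one x),
    Finset.affineCombination_eq_linear_combination _ _ _ (b.sum_coord_apply_eq_one x)] at h
  rw [← h]
  simp [mul_comm]

/-- The face of a simplex opposite to the vertex `b i`. -/
def oppositeFace (i : ι) : Set E := {x | b.coord i x = 0 ∧ ∀ j, 0 ≤ b.coord j x}

theorem convexHull_image_compl (i : ι) [Finite ι] :
    convexHull ℝ (b '' {i}ᶜ) = b.oppositeFace i := by
  classical
  have := Fintype.ofFinite ι
  apply Set.Subset.antisymm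
  · refine convexHull_min ?_ ?_
    · rintro _ ⟨k, hk, rfl⟩
      refine ⟨b.coord_apply_ne (Ne.symm hk), fun j => ?_⟩
      rw [b.coord_apply]
      split_ifs <;> simp
    · have h1 : Convex ℝ (b.coord i ⁻¹' {0}) := (convex_singleton 0).affine_preimage _
      have h2 : Convex ℝ (⋂ j, b.coord j ⁻¹' Set.Ici 0) :=
        convex_iInter fun j => (convex_Ici 0).affine_preimage _
      convert h1.inter h2 using 1
      ext x
      simp [oppositeFace]
  · rintro x ⟨h1, h2⟩
    rw [← b.affineCombination_coord_eq_self x,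
      Finset.affineCombination_eq_linear_combination _ _ _ (b.sum_coord_apply_eq_one x),
      ← Finset.sum_erase_add _ _ (Finset.mem_univ i), h1, zero_smul, add_zero]
    refine (convex_convexHull ℝ _).sum_mem (fun j _ => h2 j) ?_ fun j hj => ?_
    · have := b.sum_coord_apply_eq_one x
      rwa [← Finset.sum_erase_add _ _ (Finset.mem_univ i), h1, add_zero] at this
    · exact subset_convexHull ℝ _ ⟨j, by simpa using hj, rfl⟩

theorem coord_linear_ne_zero [Nontrivial ι] (i : ι) : (b.coord i).linear ≠ 0 := by
  obtain ⟨j, hj⟩ := exists_ne i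
  intro h
  have := (b.coord i).linearMap_vsub (b i) (b j)
  rw [h, b.coord_apply_eq, b.coord_apply_ne hj.symm] at this
  simp at this

/-- The affine map exchanging the vertices `b i` and `b j`. -/
def swapMap (i j : ι) : E →ᵃ[ℝ] E :=
  (LinearMap.toSpanSingleton ℝ E (b j - b i)).toAffineMap.comp (b.coord i - b.coord j) +
    AffineMap.id ℝ E

/-- Moving by `λ_i - λ_j` times `b j - b i` changes `λ_k` by that amount for `k = j`, by its
negative for `k = i`, and not at all otherwise. -/
theorem coord_swapMap [DecidableEq ι] (i j k : ι) (x : E) :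
    b.coord k (b.swapMap i j x) = b.coord (Equiv.swap i j k) x := by
  have h1 : b.swapMap i j x = (b.coord i x - b.coord j x) • (b j - b i) +ᵥ x := by
    simp [swapMap, sub_smul]
  have h2 := (b.coord k).linearMap_vsub (b j) (b i)
  rw [vsub_eq_sub] at h2
  rw [h1, AffineMap.map_vadd, map_smul, h2, b.coord_apply, b.coord_apply, Equiv.swap_apply_def]
  split_ifs <;> subst_vars <;> simp_all

theorem swapMap_involutive [Finite ι] (i j : ι) (x : E) :
    b.swapMap i j (b.swapMap i j x) = x := by
  classical
  exact b.ext_elem fun k => by simp [coord_swapMap]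

theorem isCompact_oppositeFace [Finite ι] (i : ι) : IsCompact (b.oppositeFace i) := by
  rw [← convexHull_image_compl]
  exact (Set.toFinite (b '' {i}ᶜ)).isCompact_convexHull ℝ

variable [FiniteDimensional ℝ E]

theorem gradVec_eq_sum [Fintype ι] (w : E →ᵃ[ℝ] ℝ) (c : E) :
    inner ℝ c w.gradVec = ∑ j, w (b j) * inner ℝ c (b.coord j).gradVec := by
  have h : ∀ f : E →ᵃ[ℝ] ℝ, inner ℝ c f.gradVec = f c - f 0 := by
    intro f
    rw [f.apply_eq_add_inner c 0, sub_zero, real_inner_comm]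
    ring
  simp_rw [h, mul_sub, Finset.sum_sub_distrib, ← apply_eq_sum_coord]

theorem sum_inner_gradVec_coord [Fintype ι] (c : E) :
    ∑ j, inner ℝ c (b.coord j).gradVec = 0 := by
  have h : ∀ f : E →ᵃ[ℝ] ℝ, inner ℝ c f.gradVec = f c - f 0 := by
    intro f
    rw [f.apply_eq_add_inner c 0, sub_zero, real_inner_comm]
    ring
  simp_rw [h, Finset.sum_sub_distrib, b.sum_coord_apply_eq_one, sub_self]

variable [MeasurableSpace E] [BorelSpace E]

/-- The surface measure on the face opposite to `b i`, multiplied by the height of `b i`. -/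
def faceMeasure (i : ι) : Measure E :=
  ‖(b.coord i).gradVec‖ₑ⁻¹ • (μHE[finrank ℝ E - 1]).restrict (b.oppositeFace i)

theorem hausdorff_oppositeFace_lt_top [Finite ι] [Nontrivial ι] (i : ι) :
    μHE[finrank ℝ E - 1] (b.oppositeFace i) < ⊤ :=
  (b.coord i).hausdorff_lt_top_of_isCompact (b.coord_linear_ne_zero i)
    (b.isCompact_oppositeFace i) fun _ hx => hx.1

theorem integrableOn_oppositeFace [Finite ι] [Nontrivial ι] (i : ι) (w : E →ᵃ[ℝ] ℝ) :
    IntegrableOn w (b.oppositeFace i) μHE[finrank ℝ E - 1] :=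
  w.continuous_of_finiteDimensional.continuousOn.integrableOn_of_subset_isCompact
    (b.isCompact_oppositeFace i) (b.isCompact_oppositeFace i).measurableSet subset_rfl
    (b.hausdorff_oppositeFace_lt_top i).ne

/-- The swap distorts surface measure, but it exchanges the coordinate functions too, and the weight
`1/|∇λ_k|` compensates exactly. -/
theorem measurePreserving_swapMap [DecidableEq ι] [Finite ι] [Nontrivial ι] (i j k : ι) :
    MeasurePreserving (b.swapMap i j) (b.faceMeasure (Equiv.swap i j k)) (b.faceMeasure k) := by
  have hm : Measurable (b.swapMap i j) :=
    (b.swapMap i j).continuous_of_finiteDimensional.measurable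
  refine ⟨hm, ?_⟩
  ext A hA
  have hc : (b.coord k).comp (b.swapMap i j) = b.coord (Equiv.swap i j k) := by
    ext x
    exact b.coord_swapMap i j k x
  have hpre : b.swapMap i j ⁻¹' (A ∩ b.oppositeFace k) =
      b.swapMap i j ⁻¹' A ∩ b.oppositeFace (Equiv.swap i j k) := by
    ext x
    simp only [oppositeFace, Set.mem_preimage, Set.mem_inter_iff, Set.mem_ofPred_eq,
      coord_swapMap]
    refine and_congr_right fun _ => and_congr_right fun _ => ?_
    exact (Equiv.swap i j).forall_congr_left.trans (by simp) |>.symm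
  rw [Measure.map_apply hm hA]
  simp only [faceMeasure, Measure.smul_apply, smul_eq_mul]
  rw [Measure.restrict_apply (hm hA), Measure.restrict_apply hA, ← hpre, ← hc]
  exact (b.coord k).hausdorff_preimage_of_involutive (b.coord_linear_ne_zero k) _
    (b.swapMap_involutive i j) (hA.inter (b.isCompact_oppositeFace k).measurableSet)
    fun x hx => hx.2.1

theorem integral_coord_swap [DecidableEq ι] [Finite ι] [Nontrivial ι] (i j k l : ι) :
    ∫ x, b.coord (Equiv.swap i j l) x ∂(b.faceMeasure (Equiv.swap i j k)) =
      ∫ x, b.coord l x ∂(b.faceMeasure k) := by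
  rw [← (b.measurePreserving_swapMap i j k).map_eq, integral_map]
  · simp_rw [coord_swapMap]
  · exact (b.swapMap i j).continuous_of_finiteDimensional.aemeasurable
  · exact (b.coord l).continuous_of_finiteDimensional.aestronglyMeasurable

/-- All first moments of the scaled face measures agree. -/
theorem integral_coord_eq [Finite ι] [Nontrivial ι] {i j i' j' : ι} (h : i ≠ j) (h' : i' ≠ j') :
    ∫ x, b.coord j x ∂(b.faceMeasure i) = ∫ x, b.coord j' x ∂(b.faceMeasure i') := by
  classical
  have hvertex : ∀ {i j j' : ι}, i ≠ j → i ≠ j' →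
      ∫ x, b.coord j x ∂(b.faceMeasure i) = ∫ x, b.coord j' x ∂(b.faceMeasure i) := by
    intro i j j' h h'
    have := b.integral_coord_swap j j' i j'
    rwa [Equiv.swap_apply_right, Equiv.swap_apply_of_ne_of_ne h h'] at this
  have hface : ∀ {i i' j : ι}, j ≠ i → j ≠ i' →
      ∫ x, b.coord j x ∂(b.faceMeasure i) = ∫ x, b.coord j x ∂(b.faceMeasure i') := by
    intro i i' j h h'
    have := b.integral_coord_swap i i' i' j
    rwa [Equiv.swap_apply_right, Equiv.swap_apply_of_ne_of_ne h h'] at this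
  -- Face `i` can be moved to `i'` with `j` fixed only if `j` is not opposite to `i'`. Otherwise
  -- face and vertex are exchanged in a single swap.
  by_cases hj : j = i'
  · subst hj
    have := b.integral_coord_swap i j j i
    rw [Equiv.swap_apply_right, Equiv.swap_apply_left] at this
    rw [this]
    exact hvertex h.symm h'
  · rw [hface h.symm hj]
    exact hvertex (Ne.symm hj) h'

/-- The divergence theorem on a simplex for the product of a constant vector and an affine
function, up to identifying the constant `C` with the volume. -/
theorem exists_sum_face_integrals [Fintype ι] [Nontrivial ι] :
    ∃ C : ℝ, ∀ (c : E) (w : E →ᵃ[ℝ] ℝ),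
      ∑ i, inner ℝ c (-(‖(b.coord i).gradVec‖⁻¹ • (b.coord i).gradVec)) *
        ∫ x in b.oppositeFace i, w x ∂μHE[finrank ℝ E - 1] = C * inner ℝ c w.gradVec := by
  classical
  obtain ⟨i₀, j₀, h₀⟩ := exists_pair_ne ι
  -- The common first moment; two vertices are needed to have a face and a vertex on it.
  set C := ∫ x, b.coord j₀ x ∂(b.faceMeasure i₀) with hC
  refine ⟨C, fun c w => ?_⟩
  have hself : ∀ i, ∫ x in b.oppositeFace i, b.coord i x ∂μHE[finrank ℝ E - 1] = 0 := fun i =>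
    setIntegral_eq_zero_of_forall_eq_zero fun x hx => hx.1
  have hmom : ∀ i j, ‖(b.coord i).gradVec‖⁻¹ *
      ∫ x in b.oppositeFace i, b.coord j x ∂μHE[finrank ℝ E - 1] = if j = i then 0 else C := by
    intro i j
    split_ifs with h
    · rw [h, hself, mul_zero]
    · rw [hC, ← b.integral_coord_eq (Ne.symm h) h₀, faceMeasure, integral_smul_measure]
      simp
  have hint : ∀ i, ‖(b.coord i).gradVec‖⁻¹ *
      ∫ x in b.oppositeFace i, w x ∂μHE[finrank ℝ E - 1] = C * ((∑ j, w (b j)) - w (b i)) := by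
    intro i
    rw [integral_congr_ae (Filter.Eventually.of_forall (b.apply_eq_sum_coord w)), integral_finsetSum _ fun j _ => (b.integrableOn_oppositeFace i _).const_mul _,
      Finset.mul_sum]
    simp_rw [integral_const_mul, mul_left_comm _ (w (b _)), hmom]
    rw [← Finset.sum_erase_add _ _ (Finset.mem_univ i),
      ← Finset.sum_erase_add _ (fun j => w (b j)) (Finset.mem_univ i)]
    rw [if_pos rfl, mul_zero, add_zero, add_sub_cancel_right, Finset.mul_sum]
    refine Finset.sum_congr rfl fun j hj => ?_
    rw [if_neg (Finset.ne_of_mem_erase hj), mul_comm]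
  have hterm : ∀ i, inner ℝ c (-(‖(b.coord i).gradVec‖⁻¹ • (b.coord i).gradVec)) *
        ∫ x in b.oppositeFace i, w x ∂μHE[finrank ℝ E - 1] =
      C * (w (b i) * inner ℝ c (b.coord i).gradVec) -
        C * (∑ j, w (b j)) * inner ℝ c (b.coord i).gradVec := by
    intro i
    rw [inner_neg_right, inner_smul_right]
    linear_combination (-inner ℝ c (b.coord i).gradVec) * hint i
  -- The part containing the sum of all vertex values drops out because the gradients of the
  -- barycentric coordinates add up to zero.
  simp_rw [hterm, Finset.sum_sub_distrib, ← Finset.mul_sum, b.sum_inner_gradVec_coord,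
    ← b.gradVec_eq_sum, mul_zero, sub_zero]

end AffineBasis

/-! ### Faces and normals of mesh elements -/

namespace IPDG

variable {d : ℕ}

theorem map_massCenter {s : Finset (Pt d)} (hs : s.Nonempty) (f : Pt d →ᵃ[ℝ] ℝ) :
    f (massCenter s) = (s.card : ℝ)⁻¹ * ∑ p ∈ s, f p := by
  have hf : ∀ x, f x = f.linear x + f 0 := congrFun f.decomp
  have hc : (s.card : ℝ) ≠ 0 := by simpa using hs.ne_empty
  rw [hf, Finset.sum_congr rfl fun p _ => hf p, Finset.sum_add_distrib]
  simp only [massCenter, map_smul, map_sum, smul_eq_mul, Finset.sum_const, nsmul_eq_mul]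
  field_simp

namespace Mesh

variable {M : Mesh d} {T : Finset (Pt d)}

/-- The vertices of an element as an affine basis. -/
def basis (hT : T ∈ M.elems) : AffineBasis T ℝ (Pt d) :=
  ⟨fun p => p, M.indep T hT, (M.indep T hT).affineSpan_eq_top_iff_card_eq_finrank_add_one.2
    (by simp [M.card_elem T hT])⟩

@[simp]
theorem basis_apply (hT : T ∈ M.elems) (p : T) : basis hT p = p := rfl

theorem hull_eq (hT : T ∈ M.elems) : hull T = {x | ∀ i, 0 ≤ (basis hT).coord i x} := by
  rw [← AffineBasis.convexHull_eq_nonneg_coord, hull]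
  congr 1
  ext x
  simp

theorem hull_erase [DecidableEq (Pt d)] (hT : T ∈ M.elems) (p : T) :
    hull (T.erase p) = (basis hT).oppositeFace p := by
  rw [← AffineBasis.convexHull_image_compl, hull]
  congr 1
  ext x
  simp only [Finset.coe_erase, Set.mem_sdiff, Set.mem_image, Set.mem_compl_iff, basis_apply,
    Set.mem_singleton_iff, Finset.mem_coe]
  constructor
  · rintro ⟨h1, h2⟩
    exact ⟨⟨x, h1⟩, fun h => h2 (congrArg Subtype.val h), rfl⟩
  · rintro ⟨q, hq, rfl⟩
    exact ⟨q.2, fun h => hq (Subtype.ext h)⟩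

theorem exists_eq_erase [DecidableEq (Pt d)] (hT : T ∈ M.elems) {e : Finset (Pt d)} (he : e ⊆ T)
    (hcard : e.card = d) : ∃ p : T, e = T.erase p := by
  obtain ⟨p, hp, rfl⟩ := Finset.exists_eq_insert_iff.2 ⟨he, by rw [hcard, M.card_elem T hT]⟩
  exact ⟨⟨p, Finset.mem_insert_self _ _⟩, (Finset.erase_insert hp).symm⟩

theorem card_erase [DecidableEq (Pt d)] (hT : T ∈ M.elems) (p : T) :
    (T.erase p).card = d := by
  rw [Finset.card_erase_of_mem p.2, M.card_elem T hT, Nat.add_sub_cancel]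

theorem nontrivial_elem (hd : d ≠ 0) (hT : T ∈ M.elems) : Nontrivial T := by
  rw [← Fintype.one_lt_card_iff_nontrivial, Fintype.card_coe, M.card_elem T hT]
  omega

theorem gradVec_coord_ne_zero (hd : d ≠ 0) (hT : T ∈ M.elems) (p : T) :
    ((basis hT).coord p).gradVec ≠ 0 := by
  have := nontrivial_elem hd hT
  intro h
  apply (basis hT).coord_linear_ne_zero p
  ext u
  rw [← AffineMap.inner_gradVec, h]
  simp

variable [DecidableEq (Pt d)]

/-- The coordinate `λ_p` vanishes on the face, so its gradient is orthogonal to it; both spaces have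
dimension one. -/
theorem orthogonal_vectorSpan (hd : d ≠ 0) (hT : T ∈ M.elems) (p : T) :
    (vectorSpan ℝ (T.erase p : Set (Pt d)))ᗮ = ℝ ∙ ((basis hT).coord p).gradVec := by
  have hG := gradVec_coord_ne_zero hd hT p
  set G := ((basis hT).coord p).gradVec with hGdef
  have hle : vectorSpan ℝ (T.erase p : Set (Pt d)) ≤ (ℝ ∙ G)ᗮ := by
    rw [vectorSpan_def, Submodule.span_le]
    rintro _ ⟨x, hx, y, hy, rfl⟩
    have hzero : ∀ z ∈ (T.erase p : Set (Pt d)), (basis hT).coord p z = 0 := by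
      intro z hz
      have hz' := Finset.mem_erase.1 (Finset.mem_coe.1 hz)
      exact (basis hT).coord_apply_ne (j := ⟨z, hz'.2⟩) fun h => hz'.1 (congrArg Subtype.val h).symm
    rw [SetLike.mem_coe, Submodule.mem_orthogonal_singleton_iff_inner_right, hGdef,
      AffineMap.inner_gradVec]
    have := ((basis hT).coord p).linearMap_vsub x y
    rw [hzero x hx, hzero y hy] at this
    simpa using this
  have hind : AffineIndependent ℝ (fun q : T.erase p => (q : Pt d)) :=
    (M.indep T hT).mono (Finset.coe_subset.2 (Finset.erase_subset (p : Pt d) T))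
  have hrank : finrank ℝ (vectorSpan ℝ (T.erase p : Set (Pt d))) = d - 1 := by
    have h := hind.finrank_vectorSpan (n := d - 1) (by
      rw [Fintype.card_coe, card_erase hT]; omega)
    have hrange : Set.range (fun q : T.erase p => (q : Pt d)) = (T.erase p : Set (Pt d)) :=
      Subtype.range_coe
    rwa [hrange] at h
  have heq : vectorSpan ℝ (T.erase p : Set (Pt d)) = (ℝ ∙ G)ᗮ := by
    apply Submodule.eq_of_le_of_finrank_eq hle
    have h1 := Submodule.finrank_add_finrank_orthogonal (ℝ ∙ G)
    rw [finrank_span_singleton hG, finrank_euclideanSpace_fin] at h1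
    omega
  rw [heq, Submodule.orthogonal_orthogonal]

theorem coord_massCenter_erase (hd : d ≠ 0) (hT : T ∈ M.elems) (p q : T) :
    (basis hT).coord q (massCenter (T.erase p)) = if q = p then 0 else (d : ℝ)⁻¹ := by
  have hne : (T.erase p).Nonempty := by
    rw [← Finset.card_pos, card_erase hT]
    omega
  rw [map_massCenter hne, card_erase hT]
  have hval : ∀ r : T, (basis hT).coord q r = if q = r then 1 else 0 :=
    fun r => (basis hT).coord_apply q r
  split_ifs with h
  · subst h
    rw [Finset.sum_eq_zero, mul_zero]
    intro r hr
    have hr' := Finset.mem_erase.1 hr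
    exact (hval ⟨r, hr'.2⟩).trans (if_neg fun h => hr'.1 (congrArg Subtype.val h).symm)
  · rw [Finset.sum_eq_single (q : Pt d), hval, if_pos rfl, mul_one]
    · intro r hr hrq
      have hr' := Finset.mem_erase.1 hr
      exact (hval ⟨r, hr'.2⟩).trans (if_neg fun h => hrq (congrArg Subtype.val h).symm)
    · intro hq
      exact absurd (Finset.mem_erase.2 ⟨fun h' => h (Subtype.ext h'), q.2⟩) hq

theorem coord_massCenter (hT : T ∈ M.elems) (p : T) :
    (basis hT).coord p (massCenter T) = (d + 1 : ℝ)⁻¹ := by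
  have hval : ∀ r : T, (basis hT).coord p r = if p = r then 1 else 0 :=
    fun r => (basis hT).coord_apply p r
  rw [map_massCenter ⟨p, p.2⟩, M.card_elem T hT, Finset.sum_eq_single (p : Pt d), hval,
    if_pos rfl]
  · simp
  · intro r hr hrp
    exact (hval ⟨r, hr⟩).trans (if_neg fun h => hrp (congrArg Subtype.val h).symm)
  · exact fun h => absurd p.2 h

/-- From the center of `T` to that of the face, `λ_p` drops from `1/(d+1)` to `0`, so the projection
onto the line of its gradient is a negative multiple of it. -/
theorem normal_erase (hd : d ≠ 0) (hT : T ∈ M.elems) (p : T) :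
    normal T (T.erase p) =
      -(‖((basis hT).coord p).gradVec‖⁻¹ • ((basis hT).coord p).gradVec) := by
  have hG := gradVec_coord_ne_zero hd hT p
  have h := ((basis hT).coord p).apply_eq_add_inner (massCenter (T.erase p)) (massCenter T)
  rw [coord_massCenter_erase hd hT, if_pos rfl, coord_massCenter hT] at h
  have horth := orthogonal_vectorSpan hd hT p
  set G := ((basis hT).coord p).gradVec
  have hGn : 0 < ‖G‖ := norm_pos_iff.2 hG
  have hw : (vectorSpan ℝ (T.erase p : Set (Pt d)))ᗮ.starProjection
      (massCenter (T.erase p) - massCenter T) = -(((d + 1 : ℝ)⁻¹ / ‖G‖ ^ 2) • G) := by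
    simp_rw [horth]
    rw [Submodule.starProjection_singleton, ← neg_smul]
    congr 1
    rw [eq_neg_of_add_eq_zero_right h.symm]
    simp [neg_div]
  have hpos : 0 < (d + 1 : ℝ)⁻¹ / ‖G‖ ^ 2 := by positivity
  unfold normal
  simp only [hw]
  rw [norm_neg, norm_smul, Real.norm_of_nonneg hpos.le, smul_neg, smul_smul]
  congr 2
  field_simp

theorem norm_normal (hd : d ≠ 0) (hT : T ∈ M.elems) {e : Finset (Pt d)} (he : e ⊆ T)
    (hcard : e.card = d) : ‖normal T e‖ = 1 := by
  obtain ⟨p, rfl⟩ := exists_eq_erase hT he hcard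
  have hG := gradVec_coord_ne_zero hd hT p
  rw [normal_erase hd hT, norm_neg, norm_smul, norm_inv, norm_norm,
    inv_mul_cancel₀ (norm_ne_zero_iff.2 hG)]

/-- Moving from the center of a face in the direction of the inward normal, one first stays in the
element. -/
theorem eventually_mem_hull (hd : d ≠ 0) (hT : T ∈ M.elems) {e : Finset (Pt d)} (he : e ⊆ T)
    (hcard : e.card = d) :
    ∀ᶠ t : ℝ in nhdsWithin 0 (Set.Ioi 0), massCenter e - t • normal T e ∈ hull T := by
  obtain ⟨p, rfl⟩ := exists_eq_erase hT he hcard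
  rw [hull_eq hT]
  simp only [Set.mem_ofPred_eq, Filter.eventually_all]
  intro q
  by_cases hq : q = p
  · filter_upwards [self_mem_nhdsWithin] with t ht
    have ht' : 0 < t := ht
    rw [((basis hT).coord q).apply_eq_add_inner _ (massCenter (T.erase p)),
      coord_massCenter_erase hd hT, if_pos hq, normal_erase hd hT, hq, sub_sub_cancel_left,
      smul_neg, neg_neg, inner_smul_right, inner_smul_right, real_inner_self_eq_norm_sq]
    positivity
  · apply Filter.Eventually.filter_mono nhdsWithin_le_nhds
    have hc : Continuous fun t : ℝ =>
        (basis hT).coord q (massCenter (T.erase p) - t • normal T (T.erase p)) :=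
      ((basis hT).coord q).continuous_of_finiteDimensional.comp (by fun_prop)
    have h0 : 0 < (basis hT).coord q
        (massCenter (T.erase p) - (0 : ℝ) • normal T (T.erase p)) := by
      rw [zero_smul, sub_zero, coord_massCenter_erase hd hT, if_neg hq]
      positivity
    exact (hc.continuousAt.eventually (lt_mem_nhds h0)).mono fun t ht => ht.le

/-- Two different elements lie on different sides of a common face. -/
theorem normal_eq_neg (hd : d ≠ 0) (hT : T ∈ M.elems) {T' : Finset (Pt d)} (hT' : T' ∈ M.elems)
    (hne : T ≠ T') {e : Finset (Pt d)} (he : e ⊆ T) (he' : e ⊆ T') (hcard : e.card = d) :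
    normal T' e = -normal T e := by
  have hmem := eventually_mem_hull hd hT he hcard
  have hmem' := eventually_mem_hull hd hT' he' hcard
  have hn := norm_normal hd hT he hcard
  have hn' := norm_normal hd hT' he' hcard
  obtain ⟨p, hp⟩ := exists_eq_erase hT he hcard
  obtain ⟨p', hp'⟩ := exists_eq_erase hT' he' hcard
  have hG := gradVec_coord_ne_zero hd hT p
  have hcol : ∃ c : ℝ, normal T' e = c • normal T e := by
    have h1 : ((basis hT').coord p').gradVec ∈ (vectorSpan ℝ (e : Set (Pt d)))ᗮ := by
      rw [hp', orthogonal_vectorSpan hd hT']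
      exact Submodule.mem_span_singleton_self _
    rw [hp, orthogonal_vectorSpan hd hT, Submodule.mem_span_singleton] at h1
    obtain ⟨a, ha⟩ := h1
    have h2 : normal T' e = -(‖((basis hT').coord p').gradVec‖⁻¹ •
        ((basis hT').coord p').gradVec) := by
      rw [hp', normal_erase hd hT']
    have h3 : normal T e = -(‖((basis hT).coord p).gradVec‖⁻¹ •
        ((basis hT).coord p).gradVec) := by
      rw [hp, normal_erase hd hT]
    refine ⟨‖((basis hT').coord p').gradVec‖⁻¹ * a * ‖((basis hT).coord p).gradVec‖, ?_⟩
    rw [h2, h3, ← ha, smul_neg, smul_smul, smul_smul,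
      mul_inv_cancel_right₀ (norm_ne_zero_iff.2 hG)]
  obtain ⟨c, hc⟩ := hcol
  have habs : |c| = 1 := by
    rw [hc, norm_smul, hn, mul_one] at hn'
    exact hn'
  rcases eq_or_eq_neg_of_abs_eq habs with rfl | rfl
  -- With equal normals, a point just inside the face center would lie in both elements, hence by
  -- conformity in the face, although `λ_p` is positive there.
  · exfalso
    rw [one_smul] at hc
    rw [hc] at hmem'
    obtain ⟨t, ⟨h1, h2⟩, ht⟩ := ((hmem.and hmem').and self_mem_nhdsWithin).exists
    -- More than `d` common vertices would force `T = T'`.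
    have hint : (T : Set (Pt d)) ∩ T' = e := by
      rw [← Finset.coe_inter]
      congr 1
      refine (Finset.eq_of_subset_of_card_le (Finset.subset_inter he he') ?_).symm
      by_contra hlt
      apply hne
      have h3 : T ∩ T' = T := Finset.eq_of_subset_of_card_le Finset.inter_subset_left
        (by rw [M.card_elem T hT]; omega)
      exact Finset.eq_of_subset_of_card_le (Finset.inter_eq_left.1 h3)
        (by rw [M.card_elem T hT, M.card_elem T' hT'])
    have hx : massCenter e - t • normal T e ∈ hull e := by
      rw [hull, ← hint, ← M.conforming T hT T' hT']
      exact ⟨h1, h2⟩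
    rw [hp, hull_erase hT] at hx
    have h0 := hx.1
    have ht' : 0 < t := ht
    rw [((basis hT).coord p).apply_eq_add_inner _ (massCenter (T.erase p)),
      coord_massCenter_erase hd hT, if_pos rfl, normal_erase hd hT, sub_sub_cancel_left,
      smul_neg, neg_neg, inner_smul_right, inner_smul_right, real_inner_self_eq_norm_sq] at h0
    have : 0 < ‖((basis hT).coord p).gradVec‖ := norm_pos_iff.2 hG
    have : 0 < t * (‖((basis hT).coord p).gradVec‖⁻¹ * ‖((basis hT).coord p).gradVec‖ ^ 2) := by
      positivity
    linarith
  · rw [hc, neg_one_smul]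

theorem surf_erase (hT : T ∈ M.elems) (p : T) :
    surf (T.erase p) =
      (μHE[finrank ℝ (Pt d) - 1]).restrict ((basis hT).oppositeFace p) := by
  rw [surf, hull_erase hT, finrank_euclideanSpace_fin]

theorem integrable_surf (hd : d ≠ 0) (hT : T ∈ M.elems) {e : Finset (Pt d)} (he : e ⊆ T)
    (hcard : e.card = d) (w : Pt d →ᵃ[ℝ] ℝ) : Integrable w (surf e) := by
  obtain ⟨p, rfl⟩ := exists_eq_erase hT he hcard
  have := nontrivial_elem hd hT
  rw [surf_erase hT]
  exact (basis hT).integrableOn_oppositeFace p w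

theorem isFiniteMeasure_surf (hd : d ≠ 0) (hT : T ∈ M.elems) {e : Finset (Pt d)} (he : e ⊆ T)
    (hcard : e.card = d) : IsFiniteMeasure (surf e) := by
  obtain ⟨p, rfl⟩ := exists_eq_erase hT he hcard
  have := nontrivial_elem hd hT
  rw [surf_erase hT]
  exact isFiniteMeasure_restrict.2 ((basis hT).hausdorff_oppositeFace_lt_top p).ne

/-- The divergence theorem on an element, up to the value of the constant `C`. -/
theorem exists_sum_face_integrals (hd : d ≠ 0) (hT : T ∈ M.elems) :
    ∃ C : ℝ, ∀ (c : Pt d) (w : Pt d →ᵃ[ℝ] ℝ),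
      ∑ e ∈ T.powersetCard d, inner ℝ c (normal T e) * ∫ x, w x ∂(surf e) =
        C * inner ℝ c w.gradVec := by
  have := nontrivial_elem hd hT
  obtain ⟨C, hC⟩ := (basis hT).exists_sum_face_integrals
  refine ⟨C, fun c w => ?_⟩
  rw [← hC]
  symm
  refine Finset.sum_bij (fun p _ => T.erase p) ?_ ?_ ?_ ?_
  · intro p _
    exact Finset.mem_powersetCard.2 ⟨Finset.erase_subset _ _, card_erase hT p⟩
  · intro p _ q _ h
    exact Subtype.ext ((Finset.erase_inj T p.2).1 h)
  · intro e he
    obtain ⟨h1, h2⟩ := Finset.mem_powersetCard.1 he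
    obtain ⟨p, hp⟩ := exists_eq_erase hT h1 h2
    exact ⟨p, Finset.mem_univ _, hp.symm⟩
  · intro p _
    rw [surf_erase hT, normal_erase hd hT]

end Mesh
end IPDG

/-! ### Symmetry of the face terms on `Z` -/

namespace IPDG
namespace Mesh

variable {d : ℕ} {M : Mesh d}

theorem mem_faces {e : Finset (Pt d)} :
    e ∈ M.faces ↔ ∃ T ∈ M.elems, e ⊆ T ∧ e.card = d := by
  simp [faces, Finset.mem_powersetCard]

theorem mem_interiorFaces {e : Finset (Pt d)} :
    e ∈ M.interiorFaces ↔
      e ∈ M.faces ∧ ∃ T ∈ M.elems, ∃ T' ∈ M.elems, T ≠ T' ∧ e ⊆ T ∧ e ⊆ T' := by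
  simp [interiorFaces]

theorem card_face {e : Finset (Pt d)} (he : e ∈ M.faces) : e.card = d := by
  obtain ⟨_, _, _, h⟩ := mem_faces.1 he
  exact h

theorem eq_of_mem_boundary {e : Finset (Pt d)} (he : e ∈ M.faces) (hb : e ∉ M.interiorFaces)
    {T T' : Finset (Pt d)} (hT : T ∈ M.elems) (hT' : T' ∈ M.elems) (h : e ⊆ T) (h' : e ⊆ T') :
    T = T' := by
  by_contra hne
  exact hb (mem_interiorFaces.2 ⟨he, T, hT, T', hT', hne, h, h'⟩)

theorem setIntegral_gradient_comm (κ : ℝ) (T : Finset (Pt d)) (f g : Pt d →ᵃ[ℝ] ℝ) :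
    ∫ x in hull T, inner ℝ (κ • ∇ (f : Pt d → ℝ) x) (∇ (g : Pt d → ℝ) x) =
      ∫ x in hull T, inner ℝ (κ • ∇ (g : Pt d → ℝ) x) (∇ (f : Pt d → ℝ) x) := by
  simp_rw [inner_smul_left, real_inner_comm]

namespace Labelling

variable (L : M.Labelling) (κ : Finset (Pt d) → ℝ)

theorem integrable_jump (hd : d ≠ 0) (v : M.L2) {e : Finset (Pt d)} (he : e ∈ M.faces) :
    Integrable (L.jump v e) (surf e) := by
  classical
  have hp := integrable_surf hd (L.plus_mem e he) (L.subset_plus e he) (card_face he)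
  unfold jump
  split_ifs with h
  · have hm := integrable_surf hd (L.minus_mem e h) (L.subset_minus e h) (card_face he)
    exact ((hp _).smul_const _).add ((hm _).smul_const _)
  · exact (hp _).smul_const _

/-- The projected jump is constant, so the integral depends only on the product of the two
integrated jumps. -/
theorem integral_penalty_comm (hd : d ≠ 0) (v w : M.L2) (s : ℝ) {e : Finset (Pt d)}
    (he : e ∈ M.faces) :
    ∫ x, inner ℝ (s • proj e (L.jump v e)) (L.jump w e x) ∂(surf e) =
      ∫ x, inner ℝ (s • proj e (L.jump w e)) (L.jump v e x) ∂(surf e) := by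
  rw [integral_inner (L.integrable_jump hd w he), integral_inner (L.integrable_jump hd v he),
    proj, proj, average_eq, average_eq]
  simp only [inner_smul_left, RCLike.conj_to_real]
  rw [real_inner_comm]

theorem integral_avg_eq_zero (hd : d ≠ 0) {w : M.L2} (hw : w ∈ L.Z κ) {e : Finset (Pt d)}
    (he : e ∈ M.interiorFaces) :
    (1 - L.beta κ e) * ∫ x, M.loc w (L.plus e) x ∂(surf e) +
      L.beta κ e * ∫ x, M.loc w (L.minus e) x ∂(surf e) = 0 := by
  classical
  have hf : e ∈ M.faces := (mem_interiorFaces.1 he).1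
  have hp := integrable_surf hd (L.plus_mem e hf) (L.subset_plus e hf) (card_face hf)
    (M.loc w (L.plus e))
  have hm := integrable_surf hd (L.minus_mem e he) (L.subset_minus e he) (card_face hf)
    (M.loc w (L.minus e))
  have := isFiniteMeasure_surf hd (L.plus_mem e hf) (L.subset_plus e hf) (card_face hf)
  have h := measure_smul_average (surf e) (L.avg (1 - L.beta κ e) w e)
  rw [show ⨍ x, L.avg (1 - L.beta κ e) w e x ∂(surf e) = 0 from hw.2 e he, smul_zero] at h
  unfold avg at h
  rw [integral_add (hp.const_mul _) (hm.const_mul _), integral_const_mul, integral_const_mul,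
    sub_sub_cancel] at h
  exact h.symm

/-- On `Z`, the consistency term of a face is the sum of the fluxes through the face out of the
adjacent elements, tested with the traces from within. -/
theorem integral_avgFlux_jump [DecidableEq (Pt d)] (hd : d ≠ 0) (v : M.L2) {w : M.L2}
    (hw : w ∈ L.Z κ) {e : Finset (Pt d)} (he : e ∈ M.faces) :
    ∫ x, inner ℝ (L.avgFlux κ v e x) (L.jump w e x) ∂(surf e) =
      ∑ T ∈ M.elems with e ⊆ T, κ T *
        (inner ℝ (M.loc v T).gradVec (normal T e) * ∫ x, M.loc w T x ∂(surf e)) := by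
  have hpT := L.plus_mem e he
  have hpe := L.subset_plus e he
  have hcard := card_face he
  have hp := integrable_surf hd hpT hpe hcard (M.loc w (L.plus e))
  by_cases h : e ∈ M.interiorFaces
  · have hmT := L.minus_mem e h
    have hme := L.subset_minus e h
    have hne := L.minus_ne_plus e h
    have hm := integrable_surf hd hmT hme hcard (M.loc w (L.minus e))
    have hnormal := normal_eq_neg hd hpT hmT hne.symm hpe hme hcard
    have hset : M.elems.filter (e ⊆ ·) = {L.plus e, L.minus e} := by
      ext T
      simp only [Finset.mem_filter, Finset.mem_insert, Finset.mem_singleton]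
      constructor
      · rintro ⟨hT, heT⟩
        -- A third element at the face would have a normal opposite to both `n` and `-n`, forcing `n
        -- = -n` for a unit vector.
        by_contra! hcon
        have h1 := normal_eq_neg hd hpT hT hcon.1.symm hpe heT hcard
        have h2 := normal_eq_neg hd hmT hT hcon.2.symm hme heT hcard
        rw [hnormal, neg_neg, h1] at h2
        have h3 := norm_normal hd hpT hpe hcard
        have h4 := congrArg (inner ℝ (normal (L.plus e) e)) h2
        rw [inner_neg_right, real_inner_self_eq_norm_sq, h3] at h4
        norm_num at h4
      · rintro (rfl | rfl)
        exacts [⟨hpT, hpe⟩, ⟨hmT, hme⟩]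
    have hZ := L.integral_avg_eq_zero κ hd hw h
    simp only [avgFlux, jump, if_pos h, AffineMap.gradient_eq_gradVec]
    rw [hset, Finset.sum_pair hne.symm,
      integral_inner ((hp.smul_const _).add (hm.smul_const _)),
      integral_add (hp.smul_const _) (hm.smul_const _), integral_smul_const, integral_smul_const,
      hnormal]
    simp only [inner_add_left, inner_add_right, inner_smul_left, inner_smul_right, inner_neg_right,
      RCLike.conj_to_real]
    -- The coefficient is minus the flux jump across the face, taken along the normal of the plus
    -- element.
    linear_combination (κ (L.minus e) * inner ℝ (M.loc v (L.minus e)).gradVec (normal (L.plus e) e)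
      - κ (L.plus e) * inner ℝ (M.loc v (L.plus e)).gradVec (normal (L.plus e) e)) * hZ
  · have hset : M.elems.filter (e ⊆ ·) = {L.plus e} := by
      ext T
      simp only [Finset.mem_filter, Finset.mem_singleton]
      constructor
      · rintro ⟨hT, heT⟩
        exact eq_of_mem_boundary he h hT hpT heT hpe
      · rintro rfl
        exact ⟨hpT, hpe⟩
    simp only [avgFlux, jump, if_neg h, AffineMap.gradient_eq_gradVec]
    rw [hset, Finset.sum_singleton, integral_inner (hp.smul_const _), integral_smul_const,
      inner_smul_left, inner_smul_right, RCLike.conj_to_real]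
    ring

/-- The consistency form is symmetric on `Z`. -/
theorem sum_integral_avgFlux_jump_comm (hd : d ≠ 0) {v w : M.L2} (hv : v ∈ L.Z κ)
    (hw : w ∈ L.Z κ) :
    ∑ e ∈ M.faces, ∫ x, inner ℝ (L.avgFlux κ v e x) (L.jump w e x) ∂(surf e) =
      ∑ e ∈ M.faces, ∫ x, inner ℝ (L.avgFlux κ w e x) (L.jump v e x) ∂(surf e) := by
  classical
  have hsum : ∀ (v : M.L2) {w : M.L2}, w ∈ L.Z κ →
      ∑ e ∈ M.faces, ∫ x, inner ℝ (L.avgFlux κ v e x) (L.jump w e x) ∂(surf e) =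
        ∑ T ∈ M.elems, κ T * ∑ e ∈ T.powersetCard d,
          inner ℝ (M.loc v T).gradVec (normal T e) * ∫ x, M.loc w T x ∂(surf e) := by
    intro v w hw
    rw [Finset.sum_congr rfl fun e he => L.integral_avgFlux_jump κ hd v hw he]
    simp_rw [Finset.mul_sum]
    refine Finset.sum_comm' fun e T => ?_
    rw [Finset.mem_filter, Finset.mem_powersetCard, mem_faces]
    constructor
    · rintro ⟨⟨_, _, _, h1⟩, h2, h3⟩
      exact ⟨⟨h3, h1⟩, h2⟩
    · rintro ⟨⟨h3, h1⟩, h2⟩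
      exact ⟨⟨T, h2, h3, h1⟩, h2, h3⟩
  rw [hsum v hw, hsum w hv]
  refine Finset.sum_congr rfl fun T hT => ?_
  obtain ⟨C, hC⟩ := exists_sum_face_integrals hd hT
  rw [hC, hC, real_inner_comm]

end Labelling
end Mesh
end IPDG
end

theorem lemma4p1 {d : ℕ} (hd : d = 2 ∨ d = 3) (M : IPDG.Mesh d) (L : M.Labelling)
    (κ : Finset (IPDG.Pt d) → ℝ) (hκ : ∀ T ∈ M.elems, 0 < κ T)
    (α : ℝ) (hα : 0 < α) (θ : ℝ) (hθ : θ = -1 ∨ θ = 0 ∨ θ = 1) :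
    ∀ z ∈ L.Z κ, ∀ ψ ∈ L.Z κ, L.A0 κ α θ z ψ = L.A0 κ α θ ψ z := by
  intro z hz ψ hψ
  have hd0 : d ≠ 0 := by omega
  unfold IPDG.Mesh.Labelling.A0
  -- This turns the `θ` term into the consistency form with exchanged arguments, so one symmetry
  -- lemma settles both.
  simp_rw [real_inner_comm (L.avgFlux κ _ _ _) (L.jump _ _ _)]
  rw [L.sum_integral_avgFlux_jump_comm κ hd0 hz hψ,
    Finset.sum_congr rfl fun T _ =>
      IPDG.Mesh.setIntegral_gradient_comm (κ T) T (M.loc z T) (M.loc ψ T),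
    Finset.sum_congr rfl fun e he => L.integral_penalty_comm hd0 z ψ _ he]
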